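/- **Fundamental Theorem of Geometric Calculus.** Let $n\ge 1$. Multivectors are the elements of the geometric (Clifford) algebra of Euclidean space $\mathbf R^m$, in which $x^2=|x|^2$ for vectors $x$; continuity, limits and integrals of multivector valued functions are taken componentwise, and $A^\dagger$ is the reverse of $A$. A *$C^1$ singular $n$-cube* in $\mathbf R^m$ is a continuous map $\varphi:[0,1]^n\to\mathbf R^m$ which is $C^1$ with injective differential on $(0,1)^n$ and, if $n\ge 2$, is $C^1$ on $[0,1]^n$ (so that its faces have tangents). A *$C^1$ $n$-chain* is a finite formal integer combination $M=\sum_k m_k\varphi_k$ of $C^1$ singular $n$-cubes, with distinct $\varphi_k$ and $m_k\neq 0$; its points are those of $\bigcup_k\varphi_k([0,1]^n)$. For a singular $n$-cube $\varphi$ put $$J=\sqrt{\det(\partial_i\varphi\cdot\partial_j\varphi)_{i,j}},\qquad V=J^{-1}\,\partial_1\varphi\wedge\cdots\wedge\partial_n\varphi ,\qquad |dV|=J(x)\,|dx| ,\qquad dV=|dV|\,V ,$$ so that $V$ is the unit positively oriented tangent pseudoscalar, and let $$\varphi'(x,a_i)=(-1)^{n-i}\,\partial_1\varphi(x)\wedge\cdots\wedge\widehat{\partial_i\varphi(x)}\wedge\cdots\wedge\partial_n\varphi(x)$$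 be the image of the tangent $a_i$ to the hyperplane with normal $e_i$ (the hat means omission). For a closed cube $c\subseteq[0,1]^n$ with sides parallel to the axes, with image $C=\varphi(c)$, let $s_i^+$ and $s_i^-$ be the faces of $c$ orthogonal to $e_i$, with $x_i$ largest on $s_i^+$ and smallest on $s_i^-$, and put $$|C|=\int_c J(x)\,|dx|,\qquad \int_{\partial C}dA\,F=\sum_{i=1}^n\Big[\int_{s_i^+}|da|\;\varphi'(x,a_i)\,F(\varphi(x))-\int_{s_i^-}|da|\;\varphi'(x,a_i)\,F(\varphi(x))\Big].$$ The *tangential derivative* of a multivector field $F$ at $X=\varphi(x)$, $x\in(0,1)^n$, is $$\nabla_V F(X)=V^\dagger(X)\lim_{x\in c,\ \operatorname{diam}(c)\to 0}\frac1{|C|}\int_{\partial C}dA\,F ,$$ if the limit, over such cubes $c$, exists. It is computed for each singular cube of a chain separately, as a function of the parameter $x$. Integrals over a chain are the corresponding combinations of integrals over its singular cubes: $$\int_M dV\,\nabla_VF=\sum_k m_k\int_{(0,1)^n}J_k\,V_k\,\nabla_VF\;|dx|,\qquad \int_{\partial M}dA\,F=\sum_k m_k\int_{\partial\varphi_k([0,1]^n)}dA\,F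 .$$ Let $M$ be a $C^1$ $n$-chain in $\mathbf R^m$ and let $F$ be a multivector field that is continuous on $M$. Suppose that, for every singular cube $\varphi$ of $M$, the tangential derivative $\nabla_VF$ exists at every point $\varphi(x)$, $x\in(0,1)^n$, and is Lebesgue integrable on $(0,1)^n$ with respect to $|dV|$. Then $$\int_M dV\,\nabla_VF=\int_{\partial M}dA\,F .$$ -/

import Mathlib

open MeasureTheory Filter Topology Set

noncomputable section

namespace GeometricCalculus

/-! ### The geometric algebra of Euclidean space -/

/-- Euclidean space `ℝᵐ`. -/
abbrev Euc (m : ℕ) : Type := EuclideanSpace ℝ (Fin m)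

/-- The quadratic form `x ↦ x · x` on `ℝᵐ`. -/
def euclideanForm (m : ℕ) : QuadraticForm ℝ (Euc m) :=
  LinearMap.BilinMap.toQuadraticMap (innerₗ (Euc m))

theorem euclideanForm_apply (m : ℕ) (x : Euc m) : euclideanForm m x = ‖x‖ ^ 2 := by
  simp [euclideanForm]

/-- The geometric algebra of `ℝᵐ`; its elements are the multivectors. -/
abbrev Multivector (m : ℕ) : Type := CliffordAlgebra (euclideanForm m)

/-- The outer product `v₁ ∧ ⋯ ∧ v_k` of `k` vectors, as a multivector
(for `k = 0` it is `1`). -/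
def outer {m k : ℕ} (v : Fin k → Euc m) : Multivector m :=
  (CliffordAlgebra.equivExterior (euclideanForm m)).symm (ExteriorAlgebra.ιMulti ℝ k v)

/-- The basis of the geometric algebra formed by the outer products `e_{i₁} ∧ ⋯ ∧ e_{i_k}`,
`i₁ < ⋯ < i_k`, of standard basis vectors. -/
def multivectorBasis (m : ℕ) : Module.Basis (Finset (Fin m)) ℝ (Multivector m) :=
  (EuclideanSpace.basisFun (Fin m) ℝ).toBasis.ExteriorAlgebra.map
    (CliffordAlgebra.equivExterior (euclideanForm m)).symm

/-- The components of a multivector, as a vector of a Euclidean space. -/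
def components (m : ℕ) : Multivector m ≃ₗ[ℝ] EuclideanSpace ℝ (Finset (Fin m)) :=
  (multivectorBasis m).equivFun ≪≫ₗ (WithLp.linearEquiv 2 ℝ (Finset (Fin m) → ℝ)).symm

/-- The norm of a multivector is the Euclidean norm of its components. Continuity, limits,
integrability and integrals of multivector valued functions are thus componentwise. -/
instance (m : ℕ) : NormedAddCommGroup (Multivector m) :=
  NormedAddCommGroup.induced (Multivector m) (EuclideanSpace ℝ (Finset (Fin m)))
    (components m) (components m).injective

instance (m : ℕ) : NormedSpace ℝ (Multivector m) :=
  NormedSpace.induced ℝ (Multivector m) (EuclideanSpace ℝ (Finset (Fin m))) (components m)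

/-! ### Cubes in the parameter space

The dimension of cubes and chains is written `n + 1`, so that it is at least `1` and the
faces have dimension `n`. -/

/-- The closed unit cube `[0,1]ⁿ⁺¹`. -/
def unitCube (n : ℕ) : Set (Fin (n + 1) → ℝ) := Set.Icc 0 1

/-- The open unit cube `(0,1)ⁿ⁺¹`. -/
def openUnitCube (n : ℕ) : Set (Fin (n + 1) → ℝ) := {x | ∀ i, 0 < x i ∧ x i < 1}

/-- The closed cube with sides parallel to the axes, lower corner `a` and edge length `h`. -/
def cube {n : ℕ} (a : Fin (n + 1) → ℝ) (h : ℝ) : Set (Fin (n + 1) → ℝ) :=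
  Set.Icc a (fun i => a i + h)

/-- The filter on pairs `(a, h)` describing the limit over the cubes `c = cube a h` with
`h > 0` and `x ∈ c ⊆ [0,1]ⁿ⁺¹`, as `diam c → 0`. -/
def shrinkingCubes {n : ℕ} (x : Fin (n + 1) → ℝ) : Filter ((Fin (n + 1) → ℝ) × ℝ) :=
  comap (fun p => Metric.diam (cube p.1 p.2)) (𝓝 0) ⊓
    𝓟 {p | 0 < p.2 ∧ x ∈ cube p.1 p.2 ∧ cube p.1 p.2 ⊆ unitCube n}

/-! ### Singular cubes -/

/-- A (regular) `C¹` singular `(n+1)`-cube `φ` in `ℝᵐ`: `φ` is continuous on the closed cube,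
its differential exists and is continuous on the open cube and is injective there
(so that there is a tangent space and the Jacobian is positive). In dimension at least two
`φ` is `C¹` on the closed cube, so that the faces of `φ` are `C¹` too; in dimension one the
faces are points and nothing more is required. -/
structure SingularCube (n m : ℕ) where
  toFun : (Fin (n + 1) → ℝ) → Euc m
  continuousOn : ContinuousOn toFun (unitCube n)
  contDiffOn : ContDiffOn ℝ 1 toFun (openUnitCube n)
  injective_fderiv : ∀ x ∈ openUnitCube n, Function.Injective (fderiv ℝ toFun x)
  contDiffOn_closed : n ≠ 0 → ContDiffOn ℝ 1 toFun (unitCube n)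

namespace SingularCube

variable {n m : ℕ}

/-- The partial derivative `∂ᵢφ(x)` (one-sided where necessary), for `x` in the closed cube. -/
def partialDeriv (φ : SingularCube n m) (x : Fin (n + 1) → ℝ) (i : Fin (n + 1)) : Euc m :=
  fderivWithin ℝ φ.toFun (unitCube n) x (Pi.single i 1)

/-- The Jacobian `J(x)`: the square root of the Gram determinant of the `∂ᵢφ(x)`. -/
def jacobian (φ : SingularCube n m) (x : Fin (n + 1) → ℝ) : ℝ :=
  Real.sqrt (Matrix.gram ℝ (φ.partialDeriv x)).det

/-- The tangent `V` at `φ(x)`: the unit positively oriented pseudoscalar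
`J(x)⁻¹ ∂₁φ(x) ∧ ⋯ ∧ ∂ₙ₊₁φ(x)` of the tangent algebra. -/
def tangent (φ : SingularCube n m) (x : Fin (n + 1) → ℝ) : Multivector m :=
  (φ.jacobian x)⁻¹ • outer (φ.partialDeriv x)

/-- The volume measure `|dV| = J(x) |dv|` of the singular cube, read in the parameter. -/
def volumeMeasure (φ : SingularCube n m) : Measure (Fin (n + 1) → ℝ) :=
  (volume.restrict (openUnitCube n)).withDensity (fun x => ENNReal.ofReal (φ.jacobian x))

/-- The directed integral `∫ dV G = ∫ |dV| V G` over the singular cube, of a field `G`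
given as a function of the parameter. -/
def integral (φ : SingularCube n m) (G : (Fin (n + 1) → ℝ) → Multivector m) : Multivector m :=
  ∫ x, φ.tangent x * G x ∂φ.volumeMeasure

/-- `φ'(x, aᵢ) = (-1)ⁿ⁺¹⁻ⁱ ∂₁φ ∧ ⋯ ∧ ∂ᵢφ (omitted) ∧ ⋯ ∧ ∂ₙ₊₁φ` with `i` counted from `1`,
the image under the outermorphism `φ'(x, ·)` of the tangent `aᵢ = v eᵢ` to the hyperplane
with normal `eᵢ`. (In the code `i` is counted from `0`.) -/
def faceTangent (φ : SingularCube n m) (i : Fin (n + 1)) (x : Fin (n + 1) → ℝ) :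
    Multivector m :=
  (-1 : ℝ) ^ (n + (i : ℕ)) • outer (fun j : Fin n => φ.partialDeriv x (i.succAbove j))

/-- The integral of `φ'(x, aᵢ) F(φ(x)) |da|` over the part of the hyperplane `xᵢ = t` where
the other coordinates are at least those of `a` and exceed them by at most `h`. -/
def faceIntegral (φ : SingularCube n m) (F : Euc m → Multivector m)
    (a : Fin (n + 1) → ℝ) (h : ℝ) (i : Fin (n + 1)) (t : ℝ) : Multivector m :=
  ∫ y in Set.Icc (fun j : Fin n => a (i.succAbove j)) (fun j => a (i.succAbove j) + h),
    φ.faceTangent i (i.insertNth (α := fun _ => ℝ) t y) *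
      F (φ.toFun (i.insertNth (α := fun _ => ℝ) t y))

/-- The directed integral `∫_{∂C} dA F` over the boundary of `C = φ(c)`, `c = cube a h`, where
`dA = φ'(x, ±aᵢ) |da|` on the two faces of `c` orthogonal to `eᵢ`. -/
def boundaryIntegral (φ : SingularCube n m) (F : Euc m → Multivector m)
    (a : Fin (n + 1) → ℝ) (h : ℝ) : Multivector m :=
  ∑ i, (φ.faceIntegral F a h i (a i + h) - φ.faceIntegral F a h i (a i))

/-- The mean boundary integral `|C|⁻¹ ∫_{∂C} dA F` for `C = φ(c)`, `c = cube a h`. -/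
def meanBoundaryIntegral (φ : SingularCube n m) (F : Euc m → Multivector m)
    (p : (Fin (n + 1) → ℝ) × ℝ) : Multivector m :=
  (φ.volumeMeasure.real (cube p.1 p.2))⁻¹ • φ.boundaryIntegral F p.1 p.2

/-- The tangential derivative of `F` exists at `X = φ(x)`. -/
def TangDifferentiableAt (φ : SingularCube n m) (F : Euc m → Multivector m)
    (x : Fin (n + 1) → ℝ) : Prop :=
  ∃ L, Tendsto (φ.meanBoundaryIntegral F) (shrinkingCubes x) (𝓝 L)

/-- The tangential derivative `∇_V F(X) = V†(X) lim |C|⁻¹ ∫_{∂C} dA F` at `X = φ(x)`. -/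
def tangDeriv (φ : SingularCube n m) (F : Euc m → Multivector m)
    (x : Fin (n + 1) → ℝ) : Multivector m :=
  CliffordAlgebra.reverse (φ.tangent x) * limUnder (shrinkingCubes x) (φ.meanBoundaryIntegral F)

end SingularCube

/-! ### Chains -/

/-- A `C¹` `(n+1)`-chain in `ℝᵐ`: a formal integer combination of `C¹` singular cubes. -/
abbrev Chain (n m : ℕ) : Type := SingularCube n m →₀ ℤ

namespace Chain

variable {n m : ℕ}

/-- The points of the chain: the union of the images of its singular cubes. -/
def carrier (M : Chain n m) : Set (Euc m) := ⋃ φ ∈ M.support, φ.toFun '' unitCube n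

/-- `∫_M dV ∇_V F`. -/
def integralTangDeriv (M : Chain n m) (F : Euc m → Multivector m) : Multivector m :=
  M.sum fun φ k => k • φ.integral (φ.tangDeriv F)

/-- `∫_{∂M} dA F`. -/
def boundaryIntegral (M : Chain n m) (F : Euc m → Multivector m) : Multivector m :=
  M.sum fun φ k => k • φ.boundaryIntegral F 0 1

end Chain

end GeometricCalculus

end

noncomputable section

namespace GeometricCalculus

/-! ### Outer products -/

section Outer

variable {m k : ℕ}

/-! Everything is pulled back to the parameter cube. There the boundary integral is the flux of a
continuous field, hence additive over partitions into boxes: the contributions of shared faces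
cancel. At `x` in the open cube, continuity of `J` gives `|C| = h^(n+1) (J(x) + o(1))`, so the flux
through cubes of edge `h` containing `x` has density `J L`, where `L` is the limit defining the
derivative (`boundaryIntegral_sub_isLittleO`). Since `V V† = 1`, this density is `J V ∇_V F`, the
integrand of the left side.

What remains is `integral_eq_of_cube_derivative`: an additive box function with an integrable
derivative along cubes at every point is the integral of that derivative. A Lebesgue integrable
function is Henstock integrable, and a cube has tagged partitions into cubes finer than any gauge;
on these the Riemann sum is close both to the integral and to the additive function. The derivative
need not be continuous.

As it is given only on the open cube, this is applied to `[η, 1 - η]^(n+1)`, and `η → 0`. -/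

/-- The outer product as an alternating map. -/
def outerMap (m k : ℕ) : Euc m [⋀^Fin k]→ₗ[ℝ] Multivector m :=
  (CliffordAlgebra.equivExterior (euclideanForm m)).symm.toLinearMap.compAlternatingMap
    (ExteriorAlgebra.ιMulti ℝ k)

theorem outerMap_apply (v : Fin k → Euc m) : outerMap m k v = outer v := rfl

/-- Contraction is an antiderivation, so every term carries some factor `d (v i)`. -/
theorem contractLeft_ιMulti_eq_zero {R M : Type*} [CommRing R] [AddCommGroup M] [Module R M]
    (d : Module.Dual R M) {k : ℕ} (v : Fin k → M) (hv : ∀ i, d (v i) = 0) :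
    CliffordAlgebra.contractLeft d (ExteriorAlgebra.ιMulti R k v) = 0 := by
  induction k with
  | zero => rw [ExteriorAlgebra.ιMulti_zero_apply, CliffordAlgebra.contractLeft_one]
  | succ k ih =>
    rw [ExteriorAlgebra.ιMulti_succ_apply]
    erw [CliffordAlgebra.contractLeft_ι_mul]
    rw [hv, ih (Matrix.vecTail v) fun i => hv i.succ, zero_smul, mul_zero, sub_zero]

theorem associated_neg_euclideanForm (x y : Euc m) :
    QuadraticMap.associated (R := ℝ) (-euclideanForm m) x y = -inner ℝ x y := by
  rw [QuadraticMap.associated_apply]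
  simp only [neg_apply, euclideanForm_apply, norm_add_sq_real]
  rw [show -(‖x‖ ^ 2 + 2 * inner ℝ x y + ‖y‖ ^ 2) - -‖x‖ ^ 2 - -‖y‖ ^ 2 =
    (2 : ℕ) • -inner ℝ x y by simp; ring, ← Nat.cast_smul_eq_nsmul (Module.End ℝ ℝ), smul_smul]
  simp

/-- Under the change of form, left multiplication by a vector becomes the wedge minus a contraction,
and the contraction vanishes by orthogonality. -/
theorem equivExterior_prod_ofFn_ι (e : Fin k → Euc m)
    (he : Pairwise fun i j => inner ℝ (e i) (e j) = 0) :
    CliffordAlgebra.equivExterior (euclideanForm m)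
      (List.ofFn fun i => CliffordAlgebra.ι (euclideanForm m) (e i)).prod =
      ExteriorAlgebra.ιMulti ℝ k e := by
  induction k with
  | zero => simp
  | succ k ih =>
    have ih' := ih (fun i => e i.succ) fun i j hij => he (Fin.succ_injective _ |>.ne hij)
    simp only [CliffordAlgebra.equivExterior, CliffordAlgebra.changeFormEquiv_apply] at ih' ⊢
    rw [List.ofFn_succ, List.prod_cons, CliffordAlgebra.changeForm_ι_mul, ih',
      contractLeft_ιMulti_eq_zero, sub_zero, ExteriorAlgebra.ιMulti_succ_apply]
    · rfl
    · intro i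
      rw [associated_neg_euclideanForm, he (Fin.succ_ne_zero i).symm, neg_zero]

/-- The outer product of pairwise orthogonal vectors is their geometric product. -/
theorem outer_eq_prod (e : Fin k → Euc m) (he : Pairwise fun i j => inner ℝ (e i) (e j) = 0) :
    outer e = (List.ofFn fun i => CliffordAlgebra.ι (euclideanForm m) (e i)).prod := by
  rw [outer, LinearEquiv.symm_apply_eq, equivExterior_prod_ofFn_ι e he]

/-- The product telescopes from the middle, each unit vector squaring to `1`. -/
theorem prod_ofFn_ι_mul_reverse (e : Fin k → Euc m) (he : ∀ i, ‖e i‖ = 1) :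
    (List.ofFn fun i => CliffordAlgebra.ι (euclideanForm m) (e i)).prod *
      CliffordAlgebra.reverse
        (List.ofFn fun i => CliffordAlgebra.ι (euclideanForm m) (e i)).prod = 1 := by
  induction k with
  | zero => simp
  | succ k ih =>
    have ih' := ih (fun i => e i.succ) fun i => he i.succ
    rw [List.ofFn_succ, List.prod_cons, CliffordAlgebra.reverse.map_mul,
      CliffordAlgebra.reverse_ι, mul_assoc, ← mul_assoc _ (CliffordAlgebra.reverse _), ih',
      one_mul, CliffordAlgebra.ι_sq_scalar, euclideanForm_apply, he]
    simp

theorem outer_mul_reverse_of_orthonormal {e : Fin k → Euc m} (he : Orthonormal ℝ e) :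
    outer e * CliffordAlgebra.reverse (outer e) = 1 := by
  rw [outer_eq_prod e he.2, prod_ofFn_ι_mul_reverse e he.1]

/-- The outer product of linearly independent vectors is a multiple of that of an orthonormal
family, and the square of the factor is the Gram determinant. -/
theorem exists_orthonormal_outer_eq_smul {v : Fin k → Euc m} (hv : LinearIndependent ℝ v) :
    ∃ (e : Fin k → Euc m) (c : ℝ), Orthonormal ℝ e ∧ outer v = c • outer e ∧
      (Matrix.gram ℝ v).det = c ^ 2 := by
  set W := Submodule.span ℝ (range v)
  have hW : Module.finrank ℝ W = k := by
    simpa using finrank_span_eq_card hv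
  let b : OrthonormalBasis (Fin k) ℝ W := (stdOrthonormalBasis ℝ W).reindex (finCongr hW)
  let w : Fin k → W := fun i => ⟨v i, Submodule.subset_span ⟨i, rfl⟩⟩
  refine ⟨fun i => b i, b.toBasis.det w, b.orthonormal.comp_linearIsometry W.subtypeₗᵢ, ?_, ?_⟩
  -- Alternating `k`-forms on the `k`-dimensional `W` are determined by their value on one basis;
  -- `c` is the determinant of `v` in the basis `b`.
  · have key : (outerMap m k).compLinearMap W.subtype =
        b.toBasis.det.smulRight (outer fun i => (b i : Euc m)) := by
      refine Module.Basis.ext_alternating b.toBasis fun i h => ?_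
      let σ : Equiv.Perm (Fin k) := Equiv.ofBijective i (Finite.injective_iff_bijective.1 h)
      change (outerMap m k).compLinearMap W.subtype (b.toBasis ∘ σ) =
        b.toBasis.det.smulRight (outer fun i => (b i : Euc m)) (b.toBasis ∘ σ)
      rw [AlternatingMap.map_perm, AlternatingMap.map_perm]
      have hb := b.toBasis.det_self
      rw [b.coe_toBasis] at hb
      simp [hb, outerMap_apply]
    simpa [outerMap_apply] using DFunLike.congr_fun key w
  · have h1 : Matrix.gram ℝ v = Matrix.gram ℝ w := by
      ext i j
      simp [Matrix.gram_apply, w]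
    rw [h1, Matrix.gram_eq_conjTranspose_mul b, Matrix.det_mul,
      Matrix.conjTranspose_eq_transpose_of_trivial, Matrix.det_transpose, Module.Basis.det_apply,
      sq]
    rfl

theorem outer_mul_reverse {v : Fin k → Euc m} (hv : LinearIndependent ℝ v) :
    outer v * CliffordAlgebra.reverse (outer v) =
      algebraMap ℝ (Multivector m) (Matrix.gram ℝ v).det := by
  obtain ⟨e, c, he, h, hd⟩ := exists_orthonormal_outer_eq_smul hv
  rw [h, hd, map_smul, smul_mul_smul_comm, outer_mul_reverse_of_orthonormal he,
    Algebra.algebraMap_eq_smul_one, sq]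

end Outer

/-! ### Topology of the geometric algebra -/

section Topology

variable {m k : ℕ}

instance (m : ℕ) : FiniteDimensional ℝ (Multivector m) :=
  (multivectorBasis m).finiteDimensional_of_finite

theorem exists_norm_mul_le (m : ℕ) :
    ∃ C : ℝ, 0 ≤ C ∧ ∀ A B : Multivector m, ‖A * B‖ ≤ C * ‖A‖ * ‖B‖ := by
  let T : Multivector m →L[ℝ] Multivector m →L[ℝ] Multivector m :=
    (LinearMap.toContinuousLinearMap.toLinearMap ∘ₗ
      LinearMap.mul ℝ (Multivector m)).toContinuousLinearMap
  exact ⟨‖T‖, T.opNorm_nonneg, fun A B => T.le_opNorm₂ A B⟩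

theorem continuous_multivector_mul (m : ℕ) :
    Continuous fun p : Multivector m × Multivector m => p.1 * p.2 := by
  let T : Multivector m →L[ℝ] Multivector m →L[ℝ] Multivector m :=
    (LinearMap.toContinuousLinearMap.toLinearMap ∘ₗ
      LinearMap.mul ℝ (Multivector m)).toContinuousLinearMap
  exact T.continuous₂

instance (m : ℕ) : ContinuousMul (Multivector m) := ⟨continuous_multivector_mul m⟩

/-- By multilinearity the outer product is polynomial in the coordinates. -/
theorem continuous_outer : Continuous (outer : (Fin k → Euc m) → Multivector m) := by
  have h : ∀ v : Fin k → Euc m, outer v = ∑ r : Fin k → Fin m,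
      (∏ i, v i (r i)) • outer fun i => EuclideanSpace.basisFun (Fin m) ℝ (r i) := by
    intro v
    conv_lhs =>
      rw [show v = fun i => ∑ j, v i j • EuclideanSpace.basisFun (Fin m) ℝ j from
        funext fun i => by
          simpa using ((EuclideanSpace.basisFun (Fin m) ℝ).sum_repr (v i)).symm]
    rw [← outerMap_apply, ← AlternatingMap.coe_multilinearMap, MultilinearMap.map_sum]
    simp_rw [MultilinearMap.map_smul_univ]
    rfl
  rw [funext h]
  fun_prop

theorem exists_norm_outer_le_of_orthonormal (m k : ℕ) :
    ∃ C : ℝ, ∀ e : Fin k → Euc m, Orthonormal ℝ e → ‖outer e‖ ≤ C := by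
  obtain ⟨C, hC⟩ := (isCompact_closedBall (0 : Fin k → Euc m) 1).exists_bound_of_continuousOn
    continuous_outer.continuousOn
  refine ⟨C, fun e he => hC e ?_⟩
  rw [mem_closedBall_zero_iff]
  exact (pi_norm_le_iff_of_nonneg zero_le_one).2 fun i => (he.1 i).le

end Topology

/-! ### Additive functions of boxes with a derivative along cubes -/

section BoxAdditive

open BoxIntegral
open scoped NNReal

variable {ι E : Type*} [Fintype ι] [NormedAddCommGroup E] [NormedSpace ℝ E]

/-- The integral of a continuous function over a box, as a function of the box. -/
def boxSetIntegral (f : (ι → ℝ) → E) (hf : Continuous f) (I : WithTop (Box ι)) :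
    ι →ᵇᵃ[I] E where
  toFun J := ∫ y in (J : Set (ι → ℝ)), f y
  sum_partition_boxes' J _ π hπ := by
    rw [← hπ.iUnion_eq, Prepartition.iUnion_def]
    exact (integral_biUnion_finset π.boxes (fun J _ => J.measurableSet_coe)
      π.pairwiseDisjoint fun J _ =>
        (hf.continuousOn.integrableOn_compact J.isCompact_Icc).mono_set Box.coe_subset_Icc).symm

/-- If an additive function `Φ` of the subboxes of a cube `I` has a derivative `f` along cubes
at every point of `I`, and `f` is integrable on `I`, then `Φ I` is the integral of `f`. -/
theorem integral_eq_of_cube_derivative [Nonempty ι] [CompleteSpace E] {I : Box ι} {s : ℝ}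
    (hI : ∀ i, I.upper i - I.lower i = s) (Φ : ι →ᵇᵃ[I] E) {f : (ι → ℝ) → E}
    (hf : IntegrableOn f I)
    (H : ∀ x ∈ Box.Icc I, ∀ ε > 0, ∃ δ > 0, ∀ J ≤ I, ∀ h < δ,
      (∀ i, J.upper i - J.lower i = h) → x ∈ Box.Icc J →
        ‖Φ J - volume.real (J : Set (ι → ℝ)) • f x‖ ≤ ε * volume.real (J : Set (ι → ℝ))) :
    ∫ x in (I : Set (ι → ℝ)), f x = Φ I := by
  obtain ⟨i₀⟩ := ‹Nonempty ι›
  have key := hasIntegral_iff.1 (hf.hasBoxIntegral IntegrationParams.Henstock rfl)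
  set μ := volume.real (I : Set (ι → ℝ))
  have hμ : 0 ≤ μ := measureReal_nonneg
  have hpart : ∀ ε > 0, dist (∫ x in (I : Set (ι → ℝ)), f x) (Φ I) ≤ ε + ε * μ := by
    intro ε hε
    obtain ⟨r, -, hr⟩ := key ε hε
    have H' : ∀ x, ∃ δ > 0, x ∈ Box.Icc I → ∀ J ≤ I, ∀ h < δ,
      (∀ i, J.upper i - J.lower i = h) → x ∈ Box.Icc J →
        ‖Φ J - volume.real (J : Set (ι → ℝ)) • f x‖ ≤ ε * volume.real (J : Set (ι → ℝ)) := by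
      intro x
      by_cases hx : x ∈ Box.Icc I
      · obtain ⟨δ, hδ, h⟩ := H x hx ε hε
        exact ⟨δ, hδ, fun _ => h⟩
      · exact ⟨1, one_pos, fun h => absurd h hx⟩
    choose δ hδ0 hδ using H'
    -- Boxes homothetic to the cube `I` are cubes. Each lies within `δ / 3` of its tag, so its edge
    -- is at most `2δ / 3 < δ`.
    obtain ⟨π, hπ, hπH, hπr, hπs, hπd⟩ :=
      I.exists_taggedPartition_isHenstock_isSubordinate_homothetic
        fun x => ⟨min (r I.distortion x) (δ x / 3),
          lt_min (r I.distortion x).2 (div_pos (hδ0 x) three_pos)⟩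
    have h1 := hr I.distortion π
      ⟨hπr.mono fun x _ => Subtype.coe_le_coe.1 (min_le_left _ _), fun _ => hπH,
        fun _ => hπd.le, fun _ => ⟨⊥, by rw [show π.iUnion = ↑I from hπ.iUnion_eq]; simp, by simp⟩⟩
      hπ
    have h2 : dist (integralSum f (volume.toBoxAdditive.toSMul) π) (Φ I) ≤ ε * μ := by
      rw [← Φ.sum_partition_boxes le_rfl hπ, integralSum, dist_eq_norm, ← Finset.sum_sub_distrib]
      have hvol : ∑ J ∈ π.boxes, volume.real (J : Set (ι → ℝ)) = μ :=
        (volume.toBoxAdditive (ι := ι)).sum_partition_boxes le_top hπ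
      rw [← hvol, Finset.mul_sum]
      refine norm_sum_le_of_le _ fun J hJ => ?_
      obtain ⟨k, hk⟩ := hπs J hJ
      have hsub := hπr J hJ
      rw [norm_sub_rev]
      refine hδ (π.tag J) (π.tag_mem_Icc J) J (π.le_of_mem hJ) (s / 2 ^ k) ?_
        (fun i => by rw [hk i, hI i]) (hπH J hJ)
      have hl := hsub J.lower_mem_Icc
      have hu := hsub J.upper_mem_Icc
      have hlu : dist (J.upper i₀) (J.lower i₀) ≤ δ (π.tag J) / 3 + δ (π.tag J) / 3 :=
        (dist_le_pi_dist _ _ i₀).trans ((dist_triangle_right _ _ (π.tag J)).trans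
          (add_le_add (hu.trans (min_le_right _ _)) (hl.trans (min_le_right _ _))))
      rw [← hI i₀, ← hk i₀]
      linarith [hδ0 (π.tag J), (le_abs_self _).trans ((Real.dist_eq _ _).symm.trans_le hlu)]
    exact (dist_triangle_left _ _ _).trans (add_le_add h1 h2)
  refine eq_of_forall_dist_le fun ε hε => (hpart (ε / (1 + μ)) (by positivity)).trans_eq ?_
  field_simp

/-- The boundary flux of a continuous field with components `g i` through a box. -/
def boxFlux {n : ℕ} (g : Fin (n + 1) → (Fin (n + 1) → ℝ) → E) (hg : ∀ i, Continuous (g i))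
    (I : Box (Fin (n + 1))) : Fin (n + 1) →ᵇᵃ[I] E where
  toFun J := ∑ i : Fin (n + 1),
    ((∫ y in (J.face i : Set (Fin n → ℝ)), g i (i.insertNth (α := fun _ => ℝ) (J.upper i) y)) -
      ∫ y in (J.face i : Set (Fin n → ℝ)), g i (i.insertNth (α := fun _ => ℝ) (J.lower i) y))
  sum_partition_boxes' J hJ π hπ := by
    -- For each fixed direction, upper face minus lower face is already additive.
    rw [Finset.sum_comm]
    refine Finset.sum_congr rfl fun i _ => ?_
    exact (BoxAdditiveMap.upperSubLower I i
      (fun t K => ∫ y in (K : Set (Fin n → ℝ)), g i (i.insertNth (α := fun _ => ℝ) t y))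
      (fun t => boxSetIntegral (fun y => g i (i.insertNth (α := fun _ => ℝ) (t : ℝ) y))
        ((hg i).comp (continuous_const.finInsertNth i continuous_id)) _)
      (fun _ _ _ => rfl)).sum_partition_boxes hJ hπ

theorem boxFlux_apply {n : ℕ} (g : Fin (n + 1) → (Fin (n + 1) → ℝ) → E)
    (hg : ∀ i, Continuous (g i)) (I J : Box (Fin (n + 1))) :
    boxFlux g hg I J = ∑ i : Fin (n + 1),
      ((∫ y in (J.face i : Set (Fin n → ℝ)), g i (i.insertNth (α := fun _ => ℝ) (J.upper i) y)) -
        ∫ y in (J.face i : Set (Fin n → ℝ)),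
          g i (i.insertNth (α := fun _ => ℝ) (J.lower i) y)) :=
  rfl

end BoxAdditive

/-! ### Flux through cubes and exhaustion of the open unit cube -/

section CubeFlux

open BoxIntegral

variable {n : ℕ} {E : Type*} [NormedAddCommGroup E] [NormedSpace ℝ E]

/-- The flux of the field with components `g i` through the boundary of `cube a h`. -/
def cubeFlux (g : Fin (n + 1) → (Fin (n + 1) → ℝ) → E) (a : Fin (n + 1) → ℝ) (h : ℝ) : E :=
  ∑ i : Fin (n + 1),
    ((∫ y in Icc (fun j : Fin n => a (i.succAbove j)) (fun j => a (i.succAbove j) + h),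
        g i (i.insertNth (α := fun _ => ℝ) (a i + h) y)) -
      ∫ y in Icc (fun j : Fin n => a (i.succAbove j)) (fun j => a (i.succAbove j) + h),
        g i (i.insertNth (α := fun _ => ℝ) (a i) y))

/-- Boxes are half-open and cubes closed; their faces differ by null sets. -/
theorem boxFlux_eq_cubeFlux (g : Fin (n + 1) → (Fin (n + 1) → ℝ) → E)
    (hg : ∀ i, Continuous (g i)) (I J : Box (Fin (n + 1))) {h : ℝ}
    (hJ : ∀ i, J.upper i = J.lower i + h) : boxFlux g hg I J = cubeFlux g J.lower h := by
  rw [boxFlux_apply, cubeFlux]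
  refine Finset.sum_congr rfl fun i _ => ?_
  have hface : Box.Icc (J.face i) =
      Icc (fun j : Fin n => J.lower (i.succAbove j)) (fun j => J.lower (i.succAbove j) + h) := by
    rw [Box.Icc_def]
    congr 1
    exact funext fun j => hJ _
  rw [setIntegral_congr_set (Box.coe_ae_eq_Icc (J.face i)),
    setIntegral_congr_set (Box.coe_ae_eq_Icc (J.face i)), hface, hJ i]

theorem measureReal_box_of_cube {J : Box (Fin (n + 1))} {h : ℝ}
    (hJ : ∀ i, J.upper i = J.lower i + h) :
    volume.real (J : Set (Fin (n + 1) → ℝ)) = h ^ (n + 1) := by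
  rw [measureReal_def, Box.volume_apply']
  simp [hJ]

theorem tendsto_setIntegral_face (k : ℕ) {G : ℝ → (Fin k → ℝ) → E}
    (hG : Continuous (Function.uncurry G)) {t : ℝ → ℝ} (ht : Tendsto t (𝓝[>] 0) (𝓝 (t 0)))
    (ht' : ∀ᶠ η in 𝓝[>] 0, t η ∈ Icc (0 : ℝ) 1) :
    Tendsto (fun η => ∫ y in Icc (fun _ : Fin k => η) (fun _ => η + (1 - 2 * η)), G (t η) y)
      (𝓝[>] 0) (𝓝 (∫ y in Icc (fun _ : Fin k => (0 : ℝ)) (fun _ => 0 + 1), G (t 0) y)) := by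
  have hGt : ∀ s, Continuous (G s) := fun s => hG.comp (by fun_prop : Continuous fun y => (s, y))
  obtain ⟨C, hC⟩ := ((isCompact_Icc (a := (0 : ℝ)) (b := 1)).prod
    (isCompact_Icc (a := fun _ : Fin k => (0 : ℝ)) (b := fun _ => (0 : ℝ) + 1))
      ).exists_bound_of_continuousOn hG.continuousOn
  simp_rw [← integral_indicator measurableSet_Icc]
  refine tendsto_integral_filter_of_dominated_convergence
    ((Icc (fun _ : Fin k => (0 : ℝ)) (fun _ => (0 : ℝ) + 1)).indicator fun _ => C) ?_ ?_ ?_ ?_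
  · exact Eventually.of_forall fun η =>
      (hGt _).aestronglyMeasurable.indicator measurableSet_Icc
  · filter_upwards [ht', self_mem_nhdsWithin] with η hη hη0
    refine Eventually.of_forall fun y => ?_
    by_cases hy : y ∈ Icc (fun _ : Fin k => η) (fun _ => η + (1 - 2 * η))
    · have hy' : y ∈ Icc (fun _ : Fin k => (0 : ℝ)) (fun _ => (0 : ℝ) + 1) :=
        ⟨fun j => hη0.le.trans (hy.1 j), fun j => (hy.2 j).trans (by linarith [mem_Ioi.1 hη0])⟩
      rw [indicator_of_mem hy, indicator_of_mem hy']
      exact hC (t η, y) ⟨hη, hy'⟩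
    · rw [indicator_of_notMem hy, norm_zero]
      refine indicator_apply_nonneg fun hy' => ?_
      exact (norm_nonneg _).trans (hC (t η, y) ⟨hη, hy'⟩)
  · rw [integrable_indicator_iff measurableSet_Icc]
    exact integrableOn_const isCompact_Icc.measure_lt_top.ne
  -- The indicators of the shrunken faces converge off the relative boundary of the full face, which
  -- is null.
  · have hae : (pi univ fun _ : Fin k => Ioo (0 : ℝ) (0 + 1)) =ᵐ[volume]
        Icc (fun _ : Fin k => (0 : ℝ)) (fun _ => (0 : ℝ) + 1) := Measure.univ_pi_Ioo_ae_eq_Icc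
    filter_upwards [hae.mem_iff] with y hy
    by_cases hy' : y ∈ Icc (fun _ : Fin k => (0 : ℝ)) (fun _ => (0 : ℝ) + 1)
    · rw [indicator_of_mem hy']
      have hlim : Tendsto (fun η => G (t η) y) (𝓝[>] 0) (𝓝 (G (t 0) y)) :=
        (hG.tendsto (t 0, y)).comp (ht.prodMk_nhds tendsto_const_nhds)
      refine hlim.congr' ?_
      have hev : ∀ᶠ η : ℝ in 𝓝[>] 0, ∀ j, η < y j ∧ y j < 1 - η := by
        rw [eventually_all]
        intro j
        have hj := hy.2 hy' j trivial
        rw [zero_add] at hj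
        filter_upwards [nhdsWithin_le_nhds (eventually_lt_nhds hj.1),
          nhdsWithin_le_nhds (eventually_lt_nhds (sub_pos.2 hj.2))] with η h1 h2
        exact ⟨h1, by linarith⟩
      filter_upwards [hev] with η hη
      rw [indicator_of_mem]
      exact ⟨fun j => (hη j).1.le, fun j => by linarith [(hη j).2]⟩
    · rw [indicator_of_notMem hy']
      refine tendsto_const_nhds.congr' ?_
      filter_upwards [self_mem_nhdsWithin] with η hη
      rw [indicator_of_notMem]
      exact fun h => hy' ⟨fun j => hη.le.trans (h.1 j),
        fun j => (h.2 j).trans (by linarith [mem_Ioi.1 hη])⟩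

theorem tendsto_cubeFlux_inner {g : Fin (n + 1) → (Fin (n + 1) → ℝ) → E}
    (hg : ∀ i, Continuous (g i)) :
    Tendsto (fun η => cubeFlux g (fun _ => η) (1 - 2 * η)) (𝓝[>] 0) (𝓝 (cubeFlux g 0 1)) := by
  refine tendsto_finsetSum _ fun i _ => ?_
  have hG : Continuous (Function.uncurry fun (s : ℝ) (y : Fin n → ℝ) =>
      g i (i.insertNth (α := fun _ => ℝ) s y)) :=
    (hg i).comp (continuous_fst.finInsertNth (A := fun _ => ℝ) i continuous_snd)
  have hev : ∀ᶠ η : ℝ in 𝓝[>] 0, η ∈ Ioc (0 : ℝ) 1 := Ioc_mem_nhdsGT one_pos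
  refine Tendsto.sub ?_ ?_
  · have := tendsto_setIntegral_face n hG (t := fun η => η + (1 - 2 * η))
      ((Continuous.tendsto (by fun_prop) 0).mono_left nhdsWithin_le_nhds)
      (hev.mono fun η hη => ⟨by linarith [hη.2], by linarith [hη.1]⟩)
    simpa using this
  · have := tendsto_setIntegral_face n hG (t := fun η => η)
      (tendsto_id.mono_left nhdsWithin_le_nhds) (hev.mono fun η hη => ⟨hη.1.le, hη.2⟩)
    simpa using this

theorem measurableSet_openUnitCube (n : ℕ) : MeasurableSet (openUnitCube n) := by
  unfold openUnitCube
  measurability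

/-- If the flux through the boundary of small cubes has density `f` at every point of the open
unit cube, and `f` is integrable there, then the flux through the boundary of the unit cube is
the integral of `f`. -/
theorem setIntegral_openUnitCube_eq_cubeFlux [CompleteSpace E]
    {g : Fin (n + 1) → (Fin (n + 1) → ℝ) → E} (hg : ∀ i, Continuous (g i))
    {f : (Fin (n + 1) → ℝ) → E} (hf : IntegrableOn f (openUnitCube n))
    (H : ∀ x ∈ openUnitCube n, ∀ ε > 0, ∃ δ > 0, ∀ a h, 0 < h → h < δ → x ∈ cube a h →
      cube a h ⊆ unitCube n → ‖cubeFlux g a h - h ^ (n + 1) • f x‖ ≤ ε * h ^ (n + 1)) :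
    ∫ x in openUnitCube n, f x = cubeFlux g 0 1 := by
  -- `η < 1 / 2` keeps the inner cube nondegenerate, and `η > 0` keeps it inside the open cube,
  -- where `H` applies.
  have hev : ∀ᶠ η : ℝ in 𝓝[>] 0, η ∈ Ioo (0 : ℝ) (1 / 2) := Ioo_mem_nhdsGT (by norm_num)
  have hinner : ∀ᶠ η : ℝ in 𝓝[>] 0,
      ∫ x in pi univ (fun _ : Fin (n + 1) => Ioc η (1 - η)), f x =
        cubeFlux g (fun _ => η) (1 - 2 * η) := by
    filter_upwards [hev] with η hη
    let I : Box (Fin (n + 1)) := ⟨fun _ => η, fun _ => 1 - η, fun _ => by linarith [hη.2]⟩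
    have hIo : Box.Icc I ⊆ openUnitCube n := fun x hx i =>
      ⟨hη.1.trans_le (hx.1 i), (hx.2 i).trans_lt (sub_lt_self _ hη.1)⟩
    have hIc : Box.Icc I ⊆ unitCube n := fun x hx =>
      ⟨fun i => (hIo hx i).1.le, fun i => (hIo hx i).2.le⟩
    have hIu : ∀ i, I.upper i = I.lower i + (1 - 2 * η) := fun i => by
      simp only [I]; ring
    rw [← boxFlux_eq_cubeFlux g hg I I hIu, ← Box.coe_eq_pi I]
    refine integral_eq_of_cube_derivative (s := 1 - 2 * η) (fun i => by rw [hIu i]; ring) _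
      (hf.mono_set (Box.coe_subset_Icc.trans hIo)) fun x hx ε hε => ?_
    obtain ⟨δ, hδ, hδH⟩ := H x (hIo hx) ε hε
    refine ⟨δ, hδ, fun J hJI h hh hJh hxJ => ?_⟩
    have hJu : ∀ i, J.upper i = J.lower i + h := fun i => by rw [← hJh i]; ring
    have hcube : cube J.lower h = Box.Icc J := by
      rw [cube, Box.Icc_def]
      congr 1
      exact funext fun i => (hJu i).symm
    rw [boxFlux_eq_cubeFlux g hg I J hJu, measureReal_box_of_cube hJu]
    refine hδH _ h ?_ hh (hcube ▸ hxJ) (hcube ▸ (Box.le_iff_Icc.1 hJI).trans hIc)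
    rw [← hJh 0]
    exact sub_pos.2 (J.lower_lt_upper 0)
  refine tendsto_nhds_unique (Tendsto.congr' hinner ?_) (tendsto_cubeFlux_inner hg)
  have hm : ∀ η : ℝ, MeasurableSet (pi univ (fun _ : Fin (n + 1) => Ioc η (1 - η))) := fun η =>
    MeasurableSet.univ_pi fun _ => measurableSet_Ioc
  have hsub : ∀ η : ℝ, 0 < η → pi univ (fun _ : Fin (n + 1) => Ioc η (1 - η)) ⊆ openUnitCube n :=
    fun η hη x hx i => ⟨hη.trans (hx i trivial).1, (hx i trivial).2.trans_lt (sub_lt_self _ hη)⟩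
  rw [← integral_indicator (measurableSet_openUnitCube n)]
  simp_rw [← fun η => integral_indicator (μ := volume) (f := f) (hm η)]
  have hf' := (integrable_indicator_iff (measurableSet_openUnitCube n)).2 hf
  refine tendsto_integral_filter_of_dominated_convergence _ ?_ ?_ hf'.norm ?_
  · filter_upwards [self_mem_nhdsWithin] with η hη
    exact ((integrable_indicator_iff (hm η)).2 (hf.mono_set (hsub η hη))).aestronglyMeasurable
  · filter_upwards [self_mem_nhdsWithin] with η hη
    exact Eventually.of_forall fun x => norm_indicator_le_of_subset (hsub η hη) f x
  · refine Eventually.of_forall fun x => tendsto_const_nhds.congr' ?_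
    by_cases hx : x ∈ openUnitCube n
    · have hev' : ∀ᶠ η : ℝ in 𝓝[>] 0, ∀ j, η < x j ∧ x j < 1 - η := by
        rw [eventually_all]
        intro j
        filter_upwards [nhdsWithin_le_nhds (eventually_lt_nhds (hx j).1),
          nhdsWithin_le_nhds (eventually_lt_nhds (sub_pos.2 (hx j).2))] with η h1 h2
        exact ⟨h1, by linarith⟩
      filter_upwards [hev'] with η hη
      rw [indicator_of_mem hx, indicator_of_mem]
      exact fun j _ => ⟨(hη j).1, (hη j).2.le⟩
    · filter_upwards [self_mem_nhdsWithin] with η hη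
      rw [indicator_of_notMem hx, indicator_of_notMem fun h => hx (hsub η hη h)]

end CubeFlux

/-! ### Cubes in the parameter space -/

section Cubes

variable {n : ℕ}

theorem isOpen_openUnitCube (n : ℕ) : IsOpen (openUnitCube n) := by
  have : openUnitCube n = pi univ fun _ => Ioo (0 : ℝ) 1 := by
    ext x
    simp [openUnitCube]
  rw [this]
  exact isOpen_set_pi finite_univ fun _ _ => isOpen_Ioo

theorem openUnitCube_subset_unitCube (n : ℕ) : openUnitCube n ⊆ unitCube n :=
  fun _ hx => ⟨fun i => (hx i).1.le, fun i => (hx i).2.le⟩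

theorem unitCube_mem_nhds {x : Fin (n + 1) → ℝ} (hx : x ∈ openUnitCube n) : unitCube n ∈ 𝓝 x :=
  mem_of_superset ((isOpen_openUnitCube n).mem_nhds hx) (openUnitCube_subset_unitCube n)

theorem uniqueDiffOn_unitCube (n : ℕ) : UniqueDiffOn ℝ (unitCube n) := by
  rw [unitCube, ← pi_univ_Icc]
  exact UniqueDiffOn.univ_pi fun _ => uniqueDiffOn_Icc zero_lt_one

theorem cube_zero_one (n : ℕ) : cube (0 : Fin (n + 1) → ℝ) 1 = unitCube n := by
  rw [cube, unitCube]
  congr 1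
  ext i
  simp

theorem measurableSet_cube (a : Fin (n + 1) → ℝ) (h : ℝ) : MeasurableSet (cube a h) :=
  measurableSet_Icc

theorem measureReal_cube (a : Fin (n + 1) → ℝ) {h : ℝ} (hh : 0 ≤ h) :
    volume.real (cube a h) = h ^ (n + 1) := by
  rw [measureReal_def, cube, Real.volume_Icc_pi_toReal fun i => by simpa using hh]
  simp

theorem diam_cube_le (a : Fin (n + 1) → ℝ) {h : ℝ} (hh : 0 ≤ h) :
    Metric.diam (cube a h) ≤ h := by
  refine Metric.diam_le_of_forall_dist_le hh fun x hx y hy => (dist_pi_le_iff hh).2 fun i => ?_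
  rw [Real.dist_eq, abs_le]
  have := hx.1 i; have := hx.2 i; have := hy.1 i; have := hy.2 i
  constructor <;> linarith

theorem tendsto_cube_smallSets (x : Fin (n + 1) → ℝ) :
    Tendsto (fun p => cube p.1 p.2) (shrinkingCubes x) (𝓝 x).smallSets := by
  rw [tendsto_smallSets_iff]
  intro t ht
  obtain ⟨r, hr, hrt⟩ := Metric.mem_nhds_iff.1 ht
  have h1 : ∀ᶠ p in shrinkingCubes x, Metric.diam (cube p.1 p.2) < r :=
    (tendsto_comap.mono_left inf_le_left).eventually (eventually_lt_nhds hr)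
  have h2 : ∀ᶠ p in shrinkingCubes x, x ∈ cube p.1 p.2 :=
    mem_of_superset (mem_inf_of_right (mem_principal_self _)) fun p hp => hp.2.1
  filter_upwards [h1, h2] with p hp hx y hy
  exact hrt ((Metric.dist_le_diam_of_mem isCompact_Icc.isBounded hy hx).trans_lt hp)

theorem eventually_shrinkingCubes_pos (x : Fin (n + 1) → ℝ) :
    ∀ᶠ p in shrinkingCubes x, 0 < p.2 :=
  mem_of_superset (mem_inf_of_right (mem_principal_self _)) fun _ hp => hp.1

theorem exists_pos_of_eventually_shrinkingCubes {x : Fin (n + 1) → ℝ}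
    {P : (Fin (n + 1) → ℝ) × ℝ → Prop} (hP : ∀ᶠ p in shrinkingCubes x, P p) :
    ∃ δ > 0, ∀ a h, 0 < h → h < δ → x ∈ cube a h → cube a h ⊆ unitCube n → P (a, h) := by
  rw [shrinkingCubes, eventually_inf_principal, eventually_comap] at hP
  obtain ⟨δ, hδ, H⟩ := Metric.eventually_nhds_iff.1 hP
  refine ⟨δ, hδ, fun a h hh hhδ hx hsub => H ?_ (a, h) rfl ⟨hh, hx, hsub⟩⟩
  rw [Real.dist_0_eq_abs, abs_of_nonneg Metric.diam_nonneg]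
  exact (diam_cube_le a hh.le).trans_lt hhδ

/-- The nearest point of the unit cube. -/
def clampUnitCube (x : Fin (n + 1) → ℝ) : Fin (n + 1) → ℝ := fun i => max 0 (min 1 (x i))

theorem continuous_clampUnitCube : Continuous (clampUnitCube (n := n)) := by
  unfold clampUnitCube
  fun_prop

theorem clampUnitCube_mem (x : Fin (n + 1) → ℝ) : clampUnitCube x ∈ unitCube n :=
  ⟨fun _ => le_max_left _ _, fun _ => max_le zero_le_one (min_le_left _ _)⟩

theorem clampUnitCube_of_mem {x : Fin (n + 1) → ℝ} (hx : x ∈ unitCube n) :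
    clampUnitCube x = x :=
  funext fun i => (congrArg (max 0) (min_eq_right (hx.2 i))).trans (max_eq_right (hx.1 i))

end Cubes

/-! ### Singular cubes -/

namespace SingularCube

variable {n m : ℕ} (φ : SingularCube n m) {F : Euc m → Multivector m}

theorem partialDeriv_eq_fderiv {x : Fin (n + 1) → ℝ} (hx : x ∈ openUnitCube n)
    (i : Fin (n + 1)) : φ.partialDeriv x i = fderiv ℝ φ.toFun x (Pi.single i 1) := by
  rw [partialDeriv, fderivWithin_of_mem_nhds (unitCube_mem_nhds hx)]

theorem continuousOn_partialDeriv : ContinuousOn φ.partialDeriv (openUnitCube n) := by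
  refine continuousOn_pi.2 fun i => ?_
  have h := φ.contDiffOn.continuousOn_fderiv_of_isOpen (isOpen_openUnitCube n) le_rfl
  exact (h.clm_apply continuousOn_const).congr fun x hx => φ.partialDeriv_eq_fderiv hx i

theorem continuousOn_partialDeriv_unitCube (hn : n ≠ 0) :
    ContinuousOn φ.partialDeriv (unitCube n) := by
  refine continuousOn_pi.2 fun i => ?_
  have h := (φ.contDiffOn_closed hn).continuousOn_fderivWithin (uniqueDiffOn_unitCube n) le_rfl
  exact h.clm_apply continuousOn_const

theorem linearIndependent_partialDeriv {x : Fin (n + 1) → ℝ} (hx : x ∈ openUnitCube n) :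
    LinearIndependent ℝ (φ.partialDeriv x) := by
  have h := (Pi.basisFun ℝ (Fin (n + 1))).linearIndependent.map'
    (fderiv ℝ φ.toFun x).toLinearMap (LinearMap.ker_eq_bot.2 (φ.injective_fderiv x hx))
  convert! h using 1
  funext i
  simp [φ.partialDeriv_eq_fderiv hx]

theorem det_gram_pos {x : Fin (n + 1) → ℝ} (hx : x ∈ openUnitCube n) :
    0 < (Matrix.gram ℝ (φ.partialDeriv x)).det :=
  (Matrix.posDef_gram_iff_linearIndependent.2 (φ.linearIndependent_partialDeriv hx)).det_pos

theorem jacobian_nonneg (x : Fin (n + 1) → ℝ) : 0 ≤ φ.jacobian x := Real.sqrt_nonneg _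

theorem jacobian_pos {x : Fin (n + 1) → ℝ} (hx : x ∈ openUnitCube n) : 0 < φ.jacobian x :=
  Real.sqrt_pos.2 (φ.det_gram_pos hx)

theorem continuousOn_jacobian : ContinuousOn φ.jacobian (openUnitCube n) := by
  have h : Continuous fun v : Fin (n + 1) → Euc m => Real.sqrt (Matrix.gram ℝ v).det := by
    refine Real.continuous_sqrt.comp (Continuous.matrix_det ?_)
    refine continuous_matrix fun i j => ?_
    simp only [Matrix.gram_apply]
    fun_prop
  exact h.comp_continuousOn φ.continuousOn_partialDeriv

theorem continuousOn_tangent : ContinuousOn φ.tangent (openUnitCube n) :=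
  (φ.continuousOn_jacobian.inv₀ fun _ hx => (φ.jacobian_pos hx).ne').smul
    (continuous_outer.comp_continuousOn φ.continuousOn_partialDeriv)

theorem tangent_mul_reverse {x : Fin (n + 1) → ℝ} (hx : x ∈ openUnitCube n) :
    φ.tangent x * CliffordAlgebra.reverse (φ.tangent x) = 1 := by
  have hJ := φ.jacobian_pos hx
  rw [tangent, map_smul, smul_mul_smul_comm, outer_mul_reverse
    (φ.linearIndependent_partialDeriv hx), ← Real.sq_sqrt (φ.det_gram_pos hx).le,
    Algebra.algebraMap_eq_smul_one, smul_smul, ← jacobian]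
  rw [show (φ.jacobian x)⁻¹ * (φ.jacobian x)⁻¹ * φ.jacobian x ^ 2 = 1 by field_simp, one_smul]

/-- `V` is plus or minus an outer product of orthonormal vectors, so it stays bounded even if `J`
degenerates at the boundary. -/
theorem exists_norm_tangent_le :
    ∃ C : ℝ, ∀ x ∈ openUnitCube n, ‖φ.tangent x‖ ≤ C := by
  obtain ⟨C, hC⟩ := exists_norm_outer_le_of_orthonormal m (n + 1)
  refine ⟨C, fun x hx => ?_⟩
  obtain ⟨e, c, he, h, hd⟩ :=
    exists_orthonormal_outer_eq_smul (φ.linearIndependent_partialDeriv hx)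
  have hc : c ≠ 0 := by
    rintro rfl
    simpa [hd] using φ.det_gram_pos hx
  rw [tangent, h, jacobian, hd, Real.sqrt_sq_eq_abs, smul_smul, norm_smul, norm_mul, norm_inv,
    Real.norm_eq_abs, Real.norm_eq_abs, abs_abs, inv_mul_cancel₀ (abs_ne_zero.2 hc), one_mul]
  exact hC e he

theorem continuousOn_faceTangent (i : Fin (n + 1)) :
    ContinuousOn (φ.faceTangent i) (unitCube n) := by
  suffices h : ContinuousOn
      (fun x => outer fun j : Fin n => φ.partialDeriv x (i.succAbove j)) (unitCube n) from
    h.const_smul ((-1 : ℝ) ^ (n + (i : ℕ)))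
  rcases eq_or_ne n 0 with rfl | hn
  -- In dimension one the outer product is empty, hence constant, so no regularity at the endpoints
  -- is needed.
  · exact (continuousOn_const (c := outer Fin.elim0)).congr fun x _ =>
      congrArg outer (Subsingleton.elim _ _)
  · refine continuous_outer.comp_continuousOn (continuousOn_pi.2 fun j => ?_)
    exact continuousOn_pi.1 (φ.continuousOn_partialDeriv_unitCube hn) (i.succAbove j)

/-- The integrand `φ'(x, aᵢ) F(φ(x))` of the face integrals, extended from the unit cube to a
continuous function on the parameter space. -/
def faceField (F : Euc m → Multivector m) (i : Fin (n + 1)) (x : Fin (n + 1) → ℝ) :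
    Multivector m :=
  φ.faceTangent i (clampUnitCube x) * F (φ.toFun (clampUnitCube x))

theorem continuous_faceField (hF : ContinuousOn F (φ.toFun '' unitCube n)) (i : Fin (n + 1)) :
    Continuous (φ.faceField F i) :=
  ((φ.continuousOn_faceTangent i).mul
    (hF.comp φ.continuousOn (mapsTo_image _ _))).comp_continuous
      continuous_clampUnitCube clampUnitCube_mem

theorem boundaryIntegral_eq_cubeFlux (F : Euc m → Multivector m) {a : Fin (n + 1) → ℝ} {h : ℝ}
    (hh : 0 ≤ h) (hsub : cube a h ⊆ unitCube n) :
    φ.boundaryIntegral F a h = cubeFlux (φ.faceField F) a h := by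
  have key : ∀ (i : Fin (n + 1)) (t : ℝ), a i ≤ t → t ≤ a i + h → φ.faceIntegral F a h i t =
      ∫ y in Icc (fun j : Fin n => a (i.succAbove j)) (fun j => a (i.succAbove j) + h),
        φ.faceField F i (i.insertNth (α := fun _ => ℝ) t y) := by
    intro i t ht ht'
    refine setIntegral_congr_fun measurableSet_Icc fun y hy => ?_
    have hmem : i.insertNth (α := fun _ => ℝ) t y ∈ cube a h := by
      rw [cube, Fin.insertNth_mem_Icc]
      exact ⟨⟨ht, ht'⟩, hy⟩
    simp only [faceField, clampUnitCube_of_mem (hsub hmem)]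
  refine Finset.sum_congr rfl fun i _ => ?_
  rw [key i _ (by linarith) le_rfl, key i _ le_rfl (by linarith)]

theorem volumeMeasure_real_eq_setIntegral {s : Set (Fin (n + 1) → ℝ)} (hs : MeasurableSet s)
    (hsub : s ⊆ openUnitCube n) :
    φ.volumeMeasure.real s = ∫ x in s, φ.jacobian x := by
  rw [measureReal_def, volumeMeasure, withDensity_apply _ hs, Measure.restrict_restrict hs,
    inter_eq_left.2 hsub, integral_eq_lintegral_of_nonneg_ae
      (Eventually.of_forall φ.jacobian_nonneg)
      ((φ.continuousOn_jacobian.mono hsub).aestronglyMeasurable hs)]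

theorem volumeMeasure_real_cube_isLittleO {x : Fin (n + 1) → ℝ} (hx : x ∈ openUnitCube n) :
    (fun p : (Fin (n + 1) → ℝ) × ℝ =>
      φ.volumeMeasure.real (cube p.1 p.2) - p.2 ^ (n + 1) * φ.jacobian x)
      =o[shrinkingCubes x] fun p => p.2 ^ (n + 1) := by
  have ho := isOpen_openUnitCube n
  have hev : ∀ᶠ p in shrinkingCubes x, cube p.1 p.2 ⊆ openUnitCube n :=
    tendsto_smallSets_iff.1 (tendsto_cube_smallSets x) _ (ho.mem_nhds hx)
  have h := (φ.continuousOn_jacobian.continuousAt (ho.mem_nhds hx)).integral_sub_linear_isLittleO_ae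
    (μ := volume) (φ.continuousOn_jacobian.stronglyMeasurableAtFilter ho x hx)
    (tendsto_cube_smallSets x) (fun p => p.2 ^ (n + 1))
    ((eventually_shrinkingCubes_pos x).mono fun p hp => measureReal_cube p.1 hp.le)
  refine h.congr' ?_ EventuallyEq.rfl
  filter_upwards [hev] with p hp
  rw [φ.volumeMeasure_real_eq_setIntegral (measurableSet_cube _ _) hp, smul_eq_mul]

/-- With `B` the mean boundary integral, the difference is `(|C| - h^(n+1) J) B + h^(n+1) J (B -
L)`: the first term is small because `B` is bounded near its limit, the second because `B → L`. -/
theorem boundaryIntegral_sub_isLittleO {x : Fin (n + 1) → ℝ} (hx : x ∈ openUnitCube n)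
    {L : Multivector m} (hL : Tendsto (φ.meanBoundaryIntegral F) (shrinkingCubes x) (𝓝 L)) :
    (fun p : (Fin (n + 1) → ℝ) × ℝ =>
      φ.boundaryIntegral F p.1 p.2 - p.2 ^ (n + 1) • φ.jacobian x • L)
      =o[shrinkingCubes x] fun p => p.2 ^ (n + 1) := by
  have hJ := φ.jacobian_pos hx
  have hC := φ.volumeMeasure_real_cube_isLittleO hx
  have h1 := hC.smul_isBigO (hL.isBigO_one ℝ)
  have h2 := (Asymptotics.isBigO_refl (fun p : (Fin (n + 1) → ℝ) × ℝ => p.2 ^ (n + 1))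
    (shrinkingCubes x)).smul_isLittleO ((Asymptotics.isLittleO_one_iff ℝ).2
      (((hL.sub_const L).const_smul (φ.jacobian x)).trans_eq (by simp)))
  refine (h1.add h2).congr' ?_ (Eventually.of_forall fun p => by simp)
  -- The constant `J / 2` forces `|C| ≠ 0`, so the division in the mean can be undone.
  filter_upwards [hC.bound (half_pos hJ), eventually_shrinkingCubes_pos x] with p hp hp0
  have hpos : 0 < p.2 ^ (n + 1) := pow_pos hp0 _
  have hne : φ.volumeMeasure.real (cube p.1 p.2) ≠ 0 := by
    intro h0
    rw [h0, zero_sub, norm_neg, Real.norm_of_nonneg (by positivity),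
      Real.norm_of_nonneg hpos.le] at hp
    nlinarith
  have hB : φ.boundaryIntegral F p.1 p.2 =
      φ.volumeMeasure.real (cube p.1 p.2) • φ.meanBoundaryIntegral F p := by
    rw [meanBoundaryIntegral, smul_inv_smul₀ hne]
  rw [hB]
  module

theorem ae_ofReal_jacobian_lt_top (φ : SingularCube n m) :
    ∀ᵐ x ∂(volume.restrict (openUnitCube n)), ENNReal.ofReal (φ.jacobian x) < ⊤ :=
  Eventually.of_forall fun _ => ENNReal.ofReal_lt_top

theorem aemeasurable_ofReal_jacobian (φ : SingularCube n m) :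
    AEMeasurable (fun x => ENNReal.ofReal (φ.jacobian x)) (volume.restrict (openUnitCube n)) :=
  (φ.continuousOn_jacobian.aemeasurable (measurableSet_openUnitCube n)).ennreal_ofReal

theorem integral_eq_setIntegral (G : (Fin (n + 1) → ℝ) → Multivector m) :
    φ.integral G = ∫ x in openUnitCube n, φ.jacobian x • (φ.tangent x * G x) := by
  rw [integral, volumeMeasure, integral_withDensity_eq_integral_toReal_smul₀
    φ.aemeasurable_ofReal_jacobian φ.ae_ofReal_jacobian_lt_top]
  refine integral_congr_ae (Eventually.of_forall fun x => ?_)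
  simp only [ENNReal.toReal_ofReal (φ.jacobian_nonneg x)]

/-- Multiplication by the bounded continuous `V` preserves integrability of `J G`. -/
theorem integrableOn_of_integrable_volumeMeasure {G : (Fin (n + 1) → ℝ) → Multivector m}
    (hG : Integrable G φ.volumeMeasure) :
    IntegrableOn (fun x => φ.jacobian x • (φ.tangent x * G x)) (openUnitCube n) := by
  have hG' : IntegrableOn (fun x => φ.jacobian x • G x) (openUnitCube n) := by
    refine ((integrable_withDensity_iff_integrable_smul₀' φ.aemeasurable_ofReal_jacobian
      φ.ae_ofReal_jacobian_lt_top).1 hG).congr (Eventually.of_forall fun x => ?_)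
    simp only [ENNReal.toReal_ofReal (φ.jacobian_nonneg x)]
  obtain ⟨C, hC0, hC⟩ := exists_norm_mul_le m
  obtain ⟨K, hK⟩ := φ.exists_norm_tangent_le
  have hT := φ.continuousOn_tangent.aestronglyMeasurable (μ := volume)
    (measurableSet_openUnitCube n)
  simp_rw [← mul_smul_comm]
  refine (hG'.norm.const_mul (C * K)).mono' (hT.mul hG'.aestronglyMeasurable) ?_
  filter_upwards [ae_restrict_mem (measurableSet_openUnitCube n)] with x hx
  refine (hC _ _).trans ?_
  gcongr
  exact hK x hx

/-- The fundamental theorem for a single singular cube. -/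
theorem integral_tangDeriv (hF : ContinuousOn F (φ.toFun '' unitCube n))
    (hexists : ∀ x ∈ openUnitCube n, φ.TangDifferentiableAt F x)
    (hintegrable : Integrable (φ.tangDeriv F) φ.volumeMeasure) :
    φ.integral (φ.tangDeriv F) = φ.boundaryIntegral F 0 1 := by
  rw [φ.boundaryIntegral_eq_cubeFlux F zero_le_one (cube_zero_one n).subset,
    φ.integral_eq_setIntegral]
  refine setIntegral_openUnitCube_eq_cubeFlux (fun i => φ.continuous_faceField hF i)
    (φ.integrableOn_of_integrable_volumeMeasure hintegrable) fun x hx ε hε => ?_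
  have hL := tendsto_nhds_limUnder (hexists x hx)
  obtain ⟨δ, hδ, H⟩ := exists_pos_of_eventually_shrinkingCubes
    ((φ.boundaryIntegral_sub_isLittleO hx hL).bound hε)
  refine ⟨δ, hδ, fun a h hh hhδ hxa hsub => ?_⟩
  have := H a h hh hhδ hxa hsub
  -- Inserting `1 = V V†` before the limit turns `J L` into `J V ∇_V F`.
  rwa [φ.boundaryIntegral_eq_cubeFlux F hh.le hsub, Real.norm_of_nonneg (by positivity),
    ← one_mul (limUnder _ _), ← φ.tangent_mul_reverse hx, mul_assoc] at this

end SingularCube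

end GeometricCalculus

end

theorem mainTheorem1 (n m : ℕ) (M : GeometricCalculus.Chain n m)
    (F : GeometricCalculus.Euc m → GeometricCalculus.Multivector m)
    (hF : ContinuousOn F M.carrier)
    (hexists : ∀ φ ∈ M.support, ∀ x ∈ GeometricCalculus.openUnitCube n,
      φ.TangDifferentiableAt F x)
    (hintegrable : ∀ φ ∈ M.support, MeasureTheory.Integrable (φ.tangDeriv F) φ.volumeMeasure) :
    M.integralTangDeriv F = M.boundaryIntegral F := by
  refine Finset.sum_congr rfl fun φ hφ => congrArg (M φ • ·) ?_
  exact φ.integral_tangDeriv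
    (hF.mono (Set.subset_biUnion_of_mem (u := fun φ => φ.toFun '' GeometricCalculus.unitCube n) hφ))
    (hexists φ hφ) (hintegrable φ hφ)
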